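/- Let $n\ge 1$. Let $\mathcal S^n=\{(u,v)\in\mathbb C^n\times\mathbb C : 2\operatorname{Re}(v)=\|u\|^2\}$ be the Siegel model of the Heisenberg group, with group law $(u,v)*(u',v')=(u+u',\,v+v'+\sum_{i}\overline{u_i}\,u_i')$, gauge distance $d(h,h')=\|h^{-1}*h'\|$, where $\|(u,v)\|=|v|^{1/2}$, and Haar measure, normalized as Lebesgue measure in the coordinates $(u,\operatorname{Im} v)\in\mathbb C^n\times\mathbb R$. Let $\mathcal S^n(\mathbb Q)=\mathcal S^n\cap\mathbb Q[i]^{n+1}$, and for $y\in\mathcal S^n(\mathbb Q)$ let the Siegel height $\operatorname{ht}(y)$ be the minimum of $|q|$ over all $q\in\mathbb Z[i]\setminus\{0\}$ for which $y=(r_1/q,\dots,r_n/q,p/q)$ with $r_1,\dots,r_n,p\in\mathbb Z[i]$. Then: 1. For every $C>0$ and almost every $h\in\mathcal S^n$, there are infinitely many $y\in\mathcal S^n(\mathbb Q)$ with $d(h,y)\le C/\operatorname{ht}(y)$. In particular, for almost every $h\in\mathcal S^n$ there are infinitely many $y\in\mathcal S^n(\mathbb Q)$ with $d(h,y)<\operatorname{ht}(y)^{-1}$.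 2. For every $\alpha>1$, the set of $h\in\mathcal S^n$ for which infinitely many $y\in\mathcal S^n(\mathbb Q)$ satisfy $d(h,y)\le\operatorname{ht}(y)^{-\alpha}$ has measure zero. Consequently the Diophantine exponent of $\mathcal S^n$ with respect to the Siegel height is $1$ for every $n\ge1$. Here the exponent is $\alpha_0$ if almost every $h$ has infinitely many $y\in\mathcal S^n(\mathbb Q)$ with $d(h,y)\le\operatorname{ht}(y)^{-\alpha_0}$ while, for each $\varepsilon>0$, almost no $h$ has infinitely many $y\in\mathcal S^n(\mathbb Q)$ with $d(h,y)\le\operatorname{ht}(y)^{-(\alpha_0+\varepsilon)}$. -/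

import Mathlib

open MeasureTheory

/-- The Siegel model of the `n`-th Heisenberg group: the points `(u, v)` of `ℂⁿ × ℂ` with
`2 Re v = ‖u‖²`, where `‖u‖` is the Hermitian norm. -/
@[ext]
structure Siegel (n : ℕ) where
  u : Fin n → ℂ
  v : ℂ
  two_mul_re : 2 * v.re = ∑ i, ‖u i‖ ^ 2

namespace Siegel

variable {n : ℕ}

theorem star_mul_self_eq (h : Siegel n) :
    ∑ i, star (h.u i) * h.u i = h.v + star h.v := by
  have h1 : ∀ i, star (h.u i) * h.u i = ((‖h.u i‖ ^ 2 : ℝ) : ℂ) := fun i => by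
    rw [Complex.star_def, Complex.conj_mul']
    push_cast
    rfl
  rw [Finset.sum_congr rfl fun i _ => h1 i, ← Complex.ofReal_sum, ← h.two_mul_re,
    Complex.star_def, Complex.add_conj]

/-- The group law `(u, v) * (u', v') = (u + u', v + v' + ⟨u, u'⟩)`, with `⟨u, u'⟩ = ∑ ūᵢ u'ᵢ`. -/
instance : Mul (Siegel n) where
  mul h k :=
    { u := fun i => h.u i + k.u i
      v := h.v + k.v + ∑ i, star (h.u i) * k.u i
      two_mul_re := by
        have e : ∀ i, ‖h.u i + k.u i‖ ^ 2
            = ‖h.u i‖ ^ 2 + ‖k.u i‖ ^ 2 + 2 * (star (h.u i) * k.u i).re := fun i => by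
          simp only [← Complex.normSq_eq_norm_sq, Complex.normSq_apply, Complex.star_def,
            Complex.mul_re, Complex.add_re, Complex.add_im, Complex.conj_re, Complex.conj_im]
          ring
        rw [Finset.sum_congr rfl fun i _ => e i, Finset.sum_add_distrib, Finset.sum_add_distrib,
          ← h.two_mul_re, ← k.two_mul_re, ← Finset.mul_sum, Complex.add_re, Complex.add_re,
          Complex.re_sum]
        ring }

instance : One (Siegel n) where
  one := { u := fun _ => 0, v := 0, two_mul_re := by simp }

instance : Inv (Siegel n) where
  inv h := { u := fun i => -h.u i, v := star h.v, two_mul_re := by simp [h.two_mul_re] }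

@[simp] theorem mul_u (h k : Siegel n) (i : Fin n) : (h * k).u i = h.u i + k.u i := rfl
@[simp] theorem mul_v (h k : Siegel n) :
    (h * k).v = h.v + k.v + ∑ i, star (h.u i) * k.u i := rfl
@[simp] theorem one_u (i : Fin n) : (1 : Siegel n).u i = 0 := rfl
@[simp] theorem one_v : (1 : Siegel n).v = 0 := rfl
@[simp] theorem inv_u (h : Siegel n) (i : Fin n) : h⁻¹.u i = -h.u i := rfl
@[simp] theorem inv_v (h : Siegel n) : h⁻¹.v = star h.v := rfl

instance : Group (Siegel n) :=
  Group.ofLeftAxioms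
    (fun a b c => by
      ext i
      · simp [add_assoc]
      · simp only [mul_v, mul_u, star_add, add_mul, mul_add, Finset.sum_add_distrib]
        ring)
    (fun a => by
      ext i <;> simp)
    (fun a => by
      ext i
      · simp
      · have := a.star_mul_self_eq
        simp only [mul_v, inv_u, inv_v, one_v, star_neg, neg_mul, Finset.sum_neg_distrib, this]
        ring)

/-- The gauge `‖(u, v)‖ = |v|^{1/2}`. -/
noncomputable def gauge (h : Siegel n) : ℝ := Real.sqrt ‖h.v‖

/-- The left-invariant gauge distance `d(h, k) = ‖h⁻¹ * k‖`. -/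
noncomputable def gaugeDist (h k : Siegel n) : ℝ := gauge (h⁻¹ * k)

/-- The global coordinates `(u, t) ↦ (u, ‖u‖² / 2 + i t)`, a bijection `ℂⁿ × ℝ → Siegel n`. -/
noncomputable def ofCoord (p : (Fin n → ℂ) × ℝ) : Siegel n where
  u := p.1
  v := ⟨(∑ i, ‖p.1 i‖ ^ 2) / 2, p.2⟩
  two_mul_re := by simp only; ring

theorem ofCoord_bijective : Function.Bijective (ofCoord (n := n)) := by
  refine ⟨fun p q e => ?_, fun h => ⟨(h.u, h.v.im), ?_⟩⟩
  · exact Prod.ext (congrArg u e) (congrArg (fun h => h.v.im) e)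
  · refine Siegel.ext rfl (Complex.ext ?_ rfl)
    change (∑ i, ‖h.u i‖ ^ 2) / 2 = h.v.re
    rw [← h.two_mul_re]
    ring

/-- The Borel σ-algebra of `Siegel n`, as a subspace of `ℂⁿ × ℂ`. -/
noncomputable instance : MeasurableSpace (Siegel n) :=
  MeasurableSpace.comap (fun h => (h.u, h.v)) inferInstance

theorem measurable_ofCoord : Measurable (ofCoord (n := n)) := by
  refine Measurable.of_comap_le ?_
  change MeasurableSpace.comap ofCoord (MeasurableSpace.comap _ _) ≤ _
  rw [MeasurableSpace.comap_comp, ← measurable_iff_comap_le]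
  refine Measurable.prodMk measurable_fst ?_
  have e : (fun p : (Fin n → ℂ) × ℝ => (ofCoord p).v)
      = fun p => (((∑ i, ‖p.1 i‖ ^ 2) / 2 : ℝ) : ℂ) + (p.2 : ℂ) * Complex.I := by
    funext p
    exact Complex.mk_eq_add_mul_I _ _
  rw [e]
  fun_prop

/-- The Haar measure of the Heisenberg group: Lebesgue measure in the coordinates `(u, t)`. -/
noncomputable instance : MeasureSpace (Siegel n) where
  volume := Measure.map ofCoord volume

/-- The rational points: those of `Siegel n` with all coordinates in `ℚ(i)`. -/
def rationalPoints (n : ℕ) : Set (Siegel n) :=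
  {h | (∀ i, ∃ a b : ℚ, h.u i = (a : ℂ) + (b : ℂ) * Complex.I) ∧
    ∃ a b : ℚ, h.v = (a : ℂ) + (b : ℂ) * Complex.I}

/-- `q` is a denominator of `h`, i.e. `h = (r₁/q, …, rₙ/q, p/q)` with Gaussian integers
`r₁, …, rₙ, p` and `q ≠ 0`. -/
def IsDenominator (h : Siegel n) (q : GaussianInt) : Prop :=
  q ≠ 0 ∧ (∀ i, ∃ r : GaussianInt, h.u i = (r : ℂ) / (q : ℂ)) ∧
    ∃ p : GaussianInt, h.v = (p : ℂ) / (q : ℂ)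

/-- The Siegel height of a rational point: the minimal `|q|` over its denominators `q`. -/
noncomputable def height (h : Siegel n) : ℝ :=
  sInf ((fun q : GaussianInt => ‖(q : ℂ)‖) '' {q | h.IsDenominator q})

end Siegel

/-- The points `y` of the set `R` with `d(x, y) ≤ f(H(y))`. -/
def approximants {X : Type*} (d : X → X → ℝ) (R : Set X) (H : X → ℝ) (f : ℝ → ℝ) (x : X) :
    Set X :=
  {y | y ∈ R ∧ d x y ≤ f (H y)}

/-- `α` is the Diophantine exponent of `X`, with distance `d`, measure `μ`, set of rational
points `R` and height `H`: almost every point has infinitely many rational approximations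
within `H ^ (-α)`, and for each `ε > 0` almost no point has infinitely many within
`H ^ (-(α + ε))`. -/
def IsDiophantineExponent {X : Type*} [MeasurableSpace X] (μ : Measure X) (d : X → X → ℝ)
    (R : Set X) (H : X → ℝ) (α : ℝ) : Prop :=
  (∀ᵐ x ∂μ, (approximants d R H (fun z => z ^ (-α)) x).Infinite) ∧
    ∀ ε : ℝ, 0 < ε → ∀ᵐ x ∂μ, ¬ (approximants d R H (fun z => z ^ (-(α + ε))) x).Infinite

open Filter Topology

/-! ### The gauge metric, its topology and Borel structure -/

namespace Siegel

variable {n : ℕ}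

/-! A rational point `(r/q, p/q)` is an isotropic vector `(r, q, p)` of Gaussian integers for a
Hermitian form on `ℂⁿ⁺²`. Left translation by `h⁻¹` followed by a dilation of size `T` preserves the
form, sending the vector to one with coordinates `q/T` and `T q (h⁻¹ * y).v`. So an isotropic
integral vector with bounded image gives `|q| ≪ T` and `d(h, y)² ≪ 1/(T|q|)`, hence `d(h, y) ≪
1/|q|`. Such vectors exist by reduction theory (`exists_short_isotropic`), which yields the
Dirichlet theorem `exists_denominator_dist_le`.

Divergence: Dirichlet's theorem provides infinitely many approximations with some constant, for
every `h` with irrational `Im v`. Balls of radius `r` have volume comparable to `r ^ N`, so Lebesgue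
measure is doubling. Cassels' lemma `blimsup_thickening_mul_ae_eq` then allows any positive
constant, up to a null set.

Convergence: for distinct rational points, `(y⁻¹ * y').v` is a nonzero Gaussian integer over `q̄q'`,
so `d(y, y')² ≥ 1/|qq'|` (`IsDenominator.one_le_dist_sq_mul`). A volume packing in each dyadic range
of heights bounds the measures of the balls of radius `ht ^ (-α)` by a geometric series when `α >
1`, and Borel–Cantelli applies. -/

theorem gauge_nonneg (h : Siegel n) : 0 ≤ h.gauge := Real.sqrt_nonneg _

theorem gauge_sq (h : Siegel n) : h.gauge ^ 2 = ‖h.v‖ := Real.sq_sqrt (norm_nonneg _)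

theorem sum_norm_u_sq_le (h : Siegel n) : ∑ i, ‖h.u i‖ ^ 2 ≤ 2 * h.gauge ^ 2 := by
  rw [gauge_sq, ← h.two_mul_re]
  linarith [Complex.re_le_norm h.v]

theorem norm_u_le (h : Siegel n) (i : Fin n) : ‖h.u i‖ ≤ 2 * h.gauge := by
  have h1 : ‖h.u i‖ ^ 2 ≤ ∑ i, ‖h.u i‖ ^ 2 :=
    Finset.single_le_sum (f := fun i => ‖h.u i‖ ^ 2) (fun _ _ => by positivity)
      (Finset.mem_univ i)
  refine abs_le_of_sq_le_sq' ?_ (by linarith [h.gauge_nonneg]) |>.2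
  nlinarith [h.sum_norm_u_sq_le, sq_nonneg h.gauge]

theorem eq_one_of_v_eq_zero {h : Siegel n} (hv : h.v = 0) : h = 1 := by
  have hg : h.gauge = 0 := by simp [gauge, hv]
  ext i
  · have := h.norm_u_le i
    rw [hg, mul_zero] at this
    simpa using this
  · exact hv

theorem gauge_one : (1 : Siegel n).gauge = 0 := by simp [gauge]

theorem gauge_eq_zero_iff {h : Siegel n} : h.gauge = 0 ↔ h = 1 := by
  refine ⟨fun e => eq_one_of_v_eq_zero ?_, fun e => e ▸ gauge_one⟩
  rw [← norm_eq_zero, ← gauge_sq, e, zero_pow two_ne_zero]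

theorem gauge_inv (h : Siegel n) : h⁻¹.gauge = h.gauge := by simp [gauge]

/-- Cauchy–Schwarz together with `‖u‖² = 2 Re v ≤ 2|v|` bounds the cocycle term by `2‖h‖‖k‖`,
exactly the cross term of `(‖h‖ + ‖k‖)²`. -/
theorem gauge_mul_le (h k : Siegel n) : (h * k).gauge ≤ h.gauge + k.gauge := by
  refine abs_le_of_sq_le_sq' ?_ (add_nonneg h.gauge_nonneg k.gauge_nonneg) |>.2
  have hsum : ‖∑ i, star (h.u i) * k.u i‖ ≤ 2 * h.gauge * k.gauge :=
    calc ‖∑ i, star (h.u i) * k.u i‖ ≤ ∑ i, ‖h.u i‖ * ‖k.u i‖ :=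
          (norm_sum_le _ _).trans_eq (by simp)
      _ ≤ √(∑ i, ‖h.u i‖ ^ 2) * √(∑ i, ‖k.u i‖ ^ 2) := Real.sum_mul_le_sqrt_mul_sqrt _ _ _
      _ ≤ √(2 * h.gauge ^ 2) * √(2 * k.gauge ^ 2) := by
          gcongr
          exacts [h.sum_norm_u_sq_le, k.sum_norm_u_sq_le]
      _ = 2 * h.gauge * k.gauge := by
          rw [Real.sqrt_mul zero_le_two, Real.sqrt_mul zero_le_two, Real.sqrt_sq h.gauge_nonneg,
            Real.sqrt_sq k.gauge_nonneg]
          linear_combination h.gauge * k.gauge * Real.mul_self_sqrt zero_le_two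
  rw [gauge_sq, mul_v]
  calc _ ≤ ‖h.v‖ + ‖k.v‖ + 2 * h.gauge * k.gauge :=
        (norm_add_le _ _).trans (add_le_add (norm_add_le _ _) hsum)
    _ = _ := by rw [← gauge_sq, ← gauge_sq]; ring

noncomputable instance : MetricSpace (Siegel n) where
  dist := gaugeDist
  dist_self h := by simp [gaugeDist, gauge_one]
  dist_comm h k := by
    rw [gaugeDist, gaugeDist, ← gauge_inv, mul_inv_rev, inv_inv]
  dist_triangle h k l := by
    have : h⁻¹ * l = (h⁻¹ * k) * (k⁻¹ * l) := by group
    rw [gaugeDist, this]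
    exact gauge_mul_le _ _
  eq_of_dist_eq_zero {h k} e := by
    have := gauge_eq_zero_iff.1 e
    rwa [inv_mul_eq_one] at this

theorem dist_eq (h k : Siegel n) : dist h k = (h⁻¹ * k).gauge := rfl

theorem dist_sq (h k : Siegel n) : dist h k ^ 2 = ‖(h⁻¹ * k).v‖ := gauge_sq _

theorem dist_mul_left (g h k : Siegel n) : dist (g * h) (g * k) = dist h k := by
  rw [dist_eq, dist_eq]
  congr 1
  group

/-- The embedding of the Siegel model in `ℂⁿ × ℂ`. -/
def toProd (h : Siegel n) : (Fin n → ℂ) × ℂ := (h.u, h.v)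

theorem continuous_toProd : Continuous (toProd (n := n)) := by
  refine continuous_iff_continuousAt.2 fun h => ?_
  have hd : Tendsto (fun k => (h⁻¹ * k).gauge) (𝓝 h) (𝓝 0) := by
    have : Tendsto (fun k => dist h k) (𝓝 h) (𝓝 (dist h h)) :=
      tendsto_const_nhds.dist tendsto_id
    rwa [dist_self] at this
  have hu : ∀ i, Tendsto (fun k => (h⁻¹ * k).u i) (𝓝 h) (𝓝 0) := fun i =>
    squeeze_zero_norm (fun k => norm_u_le _ i) (by simpa using hd.const_mul 2)
  have hv : Tendsto (fun k => (h⁻¹ * k).v) (𝓝 h) (𝓝 0) :=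
    squeeze_zero_norm (fun k => (gauge_sq _).ge) (by simpa using hd.pow 2)
  have eu : ∀ k : Siegel n, ∀ i, k.u i = h.u i + (h⁻¹ * k).u i := fun k i => by simp
  have ev : ∀ k : Siegel n,
      k.v = h.v + (h⁻¹ * k).v + ∑ i, star (h.u i) * (h⁻¹ * k).u i := fun k => by
    conv_lhs => rw [← mul_inv_cancel_left h k]
    rfl
  refine Tendsto.prodMk_nhds (tendsto_pi_nhds.2 fun i => ?_) ?_
  · refine (tendsto_congr fun k => eu k i).2 ?_
    simpa using (hu i).const_add (h.u i)
  · refine (tendsto_congr ev).2 ?_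
    have := (hv.const_add h.v).add
      (tendsto_finsetSum Finset.univ fun i _ => (hu i).const_mul (star (h.u i)))
    simpa using this

/-- This reconciles the gauge topology with the σ-algebra, which was defined by pullback from `ℂⁿ ×
ℂ`. -/
theorem isInducing_toProd : IsInducing (toProd (n := n)) := by
  refine isInducing_iff_nhds.2 fun h => le_antisymm
    (continuous_toProd.tendsto h).le_comap ?_
  refine Metric.nhds_basis_ball.ge_iff.2 fun ε hε => ?_
  let F : (Fin n → ℂ) × ℂ → ℝ := fun p =>
    √‖h⁻¹.v + p.2 + ∑ i, star (h⁻¹.u i) * p.1 i‖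
  have hF : Continuous F := by fun_prop
  have h0 : F (toProd h) < ε := by
    have : F (toProd h) = dist h h := rfl
    rwa [this, dist_self]
  refine ⟨_, hF.continuousAt.eventually_lt continuousAt_const h0, fun k hk => ?_⟩
  rw [Metric.mem_ball, dist_comm]
  exact hk

instance : BorelSpace (Siegel n) := ⟨by
  rw [isInducing_toProd.eq_induced, borel_comap,
    ← BorelSpace.measurable_eq (α := (Fin n → ℂ) × ℂ)]
  rfl⟩

instance : SecondCountableTopology (Siegel n) := isInducing_toProd.secondCountableTopology

end Siegel

/-! ### Minkowski's theorem and bases of short lattice vectors -/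

section Lattice

open Matrix

/-- The integral vector `x`, seen as a real vector. -/
def realVec {ι : Type*} (x : ι → ℤ) : ι → ℝ := fun i => x i

/-- **Minkowski's theorem on linear forms**. -/
theorem exists_norm_mulVec_lt_one {ι : Type*} [Fintype ι] [DecidableEq ι] (A : Matrix ι ι ℝ)
    (hA0 : A.det ≠ 0) (hA : |A.det| < 1) :
    ∃ x : ι → ℤ, x ≠ 0 ∧ ‖A *ᵥ realVec x‖ < 1 := by
  let b := Pi.basisFun ℝ ι
  have hdet : LinearMap.det (Matrix.toLin' A) = A.det := LinearMap.det_toLin' A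
  -- The preimage of the open unit cube has volume `2 ^ d / |det A|`, with `d` the dimension.
  have hvol : volume (ZSpan.fundamentalDomain b) * 2 ^ Module.finrank ℝ (ι → ℝ)
      < volume (Matrix.toLin' A ⁻¹' Metric.ball 0 1) := by
    rw [Measure.addHaar_preimage_linearMap volume (by rwa [hdet]), Real.volume_pi_ball _ one_pos,
      hdet, ZSpan.fundamentalDomain_pi_basisFun, volume_pi_pi, Module.finrank_fintype_fun_eq_card]
    simp only [Real.volume_Ico, sub_zero, ENNReal.ofReal_one, Finset.prod_const_one, one_mul,
      mul_one]
    rw [ENNReal.ofReal_pow zero_le_two, ENNReal.ofReal_ofNat]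
    conv_lhs => rw [← one_mul (2 ^ _)]
    refine ENNReal.mul_lt_mul_left (by simp) (by finiteness) ?_
    rw [← ENNReal.ofReal_one, ENNReal.ofReal_lt_ofReal_iff (by positivity), abs_inv]
    exact (one_lt_inv₀ (by positivity)).2 hA
  have : Countable (Submodule.span ℤ (Set.range b)).toAddSubgroup :=
    inferInstanceAs (Countable (Submodule.span ℤ (Set.range b)))
  obtain ⟨x, hx0, hx⟩ := exists_ne_zero_mem_lattice_of_measure_mul_two_pow_lt_measure
    (ZSpan.isAddFundamentalDomain' b volume) (fun x hx => by simpa [mulVec_neg] using hx)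
    ((convex_ball (0 : ι → ℝ) 1).linear_preimage _) hvol
  have hmem : (x : ι → ℝ) ∈ Submodule.span ℤ (Set.range b) := x.2
  replace hmem := (b.mem_span_iff_repr_mem ℤ _).1 hmem
  choose y hy using hmem
  have hxy : (x : ι → ℝ) = realVec y := funext fun i => by simpa [b, realVec] using (hy i).symm
  refine ⟨y, fun h => hx0 ?_, ?_⟩
  · ext i
    rw [hxy, h]
    simp [realVec]
  · rw [← hxy]
    simpa using hx

theorem norm_dotProduct_le {ι : Type*} [Fintype ι] (x y : ι → ℝ) : |x ⬝ᵥ y| ≤ Fintype.card ι * ‖x‖ * ‖y‖ := by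
  calc |x ⬝ᵥ y| ≤ ∑ i, |x i * y i| := Finset.abs_sum_le_sum_abs _ _
    _ ≤ ∑ _i : ι, ‖x‖ * ‖y‖ := Finset.sum_le_sum fun i _ => by
        rw [abs_mul]
        exact mul_le_mul (norm_le_pi_norm x i) (norm_le_pi_norm y i) (abs_nonneg _) (norm_nonneg _)
    _ = _ := by simp [mul_assoc]

/-- If a unimodular lattice has no nonzero vector shorter than `ε`, then its vectors of length
at most a constant depending only on `ε` and the dimension span the space. -/
theorem exists_span_short_eq_top (ι : Type*) [Fintype ι] [DecidableEq ι] {ε : ℝ} (hε : 0 < ε) :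
    ∃ R : ℝ, 0 ≤ R ∧ ∀ G : Matrix ι ι ℝ, |G.det| = 1 →
      (∀ x : ι → ℤ, x ≠ 0 → ε ≤ ‖G *ᵥ realVec x‖) →
      Submodule.span ℝ {y | ∃ x : ι → ℤ, y = G *ᵥ realVec x ∧ ‖y‖ ≤ R} = ⊤ := by
  set d := Fintype.card ι with hd
  let s : ℝ := max 1 ε⁻¹
  have hs1 : 1 ≤ s := le_max_left _ _
  have hsε : s⁻¹ ≤ ε := inv_le_of_inv_le₀ hε (le_max_right _ _)
  -- The contraction factor along one direction, chosen so that `s ^ d * e = 1/2`, as Minkowski's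
  -- theorem needs a determinant below 1.
  let e : ℝ := (2 * s ^ d)⁻¹
  have he : 0 < e := by positivity
  have he1 : e < 1 := inv_lt_one_of_one_lt₀ (by linarith [one_le_pow₀ (n := d) hs1])
  refine ⟨1 + d / e, by positivity, fun G hG hmin => ?_⟩
  by_contra hspan
  obtain ⟨φ, hφ0, hφ⟩ := Submodule.exists_le_ker_of_lt_top _ (lt_top_iff_ne_top.2 hspan)
  -- If the short vectors do not span, some Euclidean unit vector `f` is orthogonal to all of them.
  obtain ⟨f, hf1, hfker⟩ : ∃ f : ι → ℝ, f ⬝ᵥ f = 1 ∧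
      ∀ x : ι → ℤ, ‖G *ᵥ realVec x‖ ≤ 1 + d / e → f ⬝ᵥ (G *ᵥ realVec x) = 0 := by
    let w : ι → ℝ := fun i => φ (Pi.single i 1)
    have hw : ∀ y, w ⬝ᵥ y = φ y := fun y => by
      conv_rhs => rw [← Finset.univ_sum_single y, map_sum]
      refine Finset.sum_congr rfl fun i _ => ?_
      rw [mul_comm, ← smul_eq_mul, ← map_smul, ← Pi.single_smul, smul_eq_mul, mul_one]
    have hw0 : 0 < w ⬝ᵥ w := by
      refine lt_of_le_of_ne (Finset.sum_nonneg fun i _ => mul_self_nonneg _) fun h => hφ0 ?_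
      have hw0 := dotProduct_self_eq_zero.1 h.symm
      refine LinearMap.ext fun y => ?_
      rw [← hw, hw0, zero_dotProduct]
      rfl
    refine ⟨(√(w ⬝ᵥ w))⁻¹ • w, ?_, fun x hx => ?_⟩
    · rw [smul_dotProduct, dotProduct_smul, smul_eq_mul, smul_eq_mul, ← mul_assoc, ← mul_inv,
        Real.mul_self_sqrt hw0.le, inv_mul_cancel₀ hw0.ne']
    · have : φ (G *ᵥ realVec x) = 0 := hφ (Submodule.subset_span ⟨x, rfl, hx⟩)
      rw [smul_dotProduct, hw (G *ᵥ realVec x), this, smul_zero]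
  have hfn : ‖f‖ ≤ 1 := by
    refine (pi_norm_le_iff_of_nonneg zero_le_one).2 fun i => ?_
    have : f i * f i ≤ 1 := hf1 ▸
      Finset.single_le_sum (f := fun i => f i * f i) (fun i _ => mul_self_nonneg _)
        (Finset.mem_univ i)
    exact abs_le_one_iff_mul_self_le_one.2 this
  -- Scale by `s` and contract by `e` along `f`. The vector found by Minkowski has small contracted
  -- image `z`; its original `y` has length at most `1 + d / e`, hence is orthogonal to `f`. So `y =
  -- z` is shorter than `ε`.
  let A : Matrix ι ι ℝ :=
    s • ((1 + replicateCol Unit ((e - 1) • f) * replicateRow Unit f) * G)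
  have hA : |A.det| = s ^ d * e := by
    rw [det_smul, det_mul, det_one_add_replicateCol_mul_replicateRow, abs_mul, abs_mul, hG,
      dotProduct_smul, hf1, smul_eq_mul, mul_one, mul_one, add_sub_cancel, abs_of_pos he,
      abs_of_nonneg (by positivity)]
  have hse : s ^ d * e = 2⁻¹ := by
    simp only [e]
    field_simp
  obtain ⟨x, hx0, hx⟩ := exists_norm_mulVec_lt_one A
    (by rw [← abs_pos, hA]; positivity) (by rw [hA, hse]; norm_num)
  set y := G *ᵥ realVec x with hy
  let z := y + ((e - 1) * (f ⬝ᵥ y)) • f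
  have hAx : A *ᵥ realVec x = s • z := by
    simp only [A, z]
    rw [smul_mulVec, ← mulVec_mulVec, ← hy, add_mulVec, one_mulVec, ← mulVec_mulVec]
    congr 2
    ext i
    simp [mulVec, dotProduct, replicateCol, replicateRow]
    ring
  have hz : ‖z‖ < s⁻¹ := by
    rw [hAx, norm_smul, Real.norm_of_nonneg (by positivity)] at hx
    rwa [← one_div, lt_div_iff₀' (by positivity)]
  have hfz : f ⬝ᵥ z = e * (f ⬝ᵥ y) := by
    simp only [z, dotProduct_add, dotProduct_smul, hf1, smul_eq_mul]
    ring
  have hfy : |f ⬝ᵥ y| ≤ d * ‖z‖ / e := by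
    rw [le_div_iff₀' he]
    calc e * |f ⬝ᵥ y| = |f ⬝ᵥ z| := by rw [hfz, abs_mul, abs_of_pos he]
      _ ≤ d * ‖f‖ * ‖z‖ := norm_dotProduct_le _ _
      _ ≤ d * 1 * ‖z‖ := by gcongr
      _ = _ := by ring
  have hz1 : ‖z‖ ≤ 1 := hz.le.trans (inv_le_one_of_one_le₀ hs1)
  have hyn : ‖y‖ ≤ 1 + d / e := by
    have : y = z - ((e - 1) * (f ⬝ᵥ y)) • f := by simp [z]
    calc ‖y‖ ≤ ‖z‖ + ‖((e - 1) * (f ⬝ᵥ y)) • f‖ := by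
          conv_lhs => rw [this]
          exact norm_sub_le _ _
      _ ≤ 1 + 1 * (d * 1 / e) * 1 := by
          rw [norm_smul, norm_mul]
          gcongr
          · rw [Real.norm_eq_abs, abs_le]
            constructor <;> linarith
          · exact hfy.trans (by gcongr)
      _ = _ := by ring
  have hzy : z = y := by
    have h0 : f ⬝ᵥ y = 0 := hfker x hyn
    simp [z, h0]
  exact absurd (hmin x hx0) (by rw [← hy, ← hzy]; linarith)

end Lattice

/-! ### Isotropic integral vectors with bounded image -/

section Isotropic

open Matrix

/-- The real matrix with the same entries as the integral matrix `S`. -/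
def realMat {ι : Type*} (S : Matrix ι ι ℤ) : Matrix ι ι ℝ := S.map (Int.castRingHom ℝ)

theorem realVec_mulVec {ι : Type*} [Fintype ι] (S : Matrix ι ι ℤ) (x : ι → ℤ) :
    realVec (S *ᵥ x) = realMat S *ᵥ realVec x :=
  funext fun i => RingHom.map_mulVec (Int.castRingHom ℝ) S x i

theorem intCast_dotProduct {ι : Type*} [Fintype ι] (x y : ι → ℤ) :
    ((x ⬝ᵥ y : ℤ) : ℝ) = realVec x ⬝ᵥ realVec y :=
  RingHom.map_dotProduct (Int.castRingHom ℝ) x y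

theorem mulVec_dotProduct_mulVec {R ι : Type*} [CommRing R] [Fintype ι] (A S : Matrix ι ι R)
    (x y : ι → R) : (A *ᵥ x) ⬝ᵥ S *ᵥ (A *ᵥ y) = x ⬝ᵥ (Aᵀ * S * A) *ᵥ y := by
  rw [← mulVec_mulVec, ← mulVec_mulVec, dotProduct_mulVec x, vecMul_transpose]

theorem exists_abs_bilin_le {ι : Type*} [Fintype ι] (S : Matrix ι ι ℝ) :
    ∃ K : ℝ, 0 ≤ K ∧ ∀ x y : ι → ℝ, |x ⬝ᵥ S *ᵥ y| ≤ K * ‖x‖ * ‖y‖ := by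
  refine ⟨∑ i, ∑ j, |S i j|, by positivity, fun x y => ?_⟩
  simp only [dotProduct, mulVec, Finset.mul_sum, Finset.sum_mul]
  refine (Finset.abs_sum_le_sum_abs _ _).trans (Finset.sum_le_sum fun i _ =>
    (Finset.abs_sum_le_sum_abs _ _).trans (Finset.sum_le_sum fun j _ => ?_))
  rw [abs_mul, abs_mul]
  calc |x i| * (|S i j| * |y j|) ≤ ‖x‖ * (|S i j| * ‖y‖) := by
        gcongr
        exacts [norm_le_pi_norm x i, norm_le_pi_norm y j]
    _ = _ := by ring

/-- Among the integral forms with bounded coefficients, the isotropic ones have isotropic vectors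
that are bounded uniformly. -/
theorem exists_bounded_isotropic (ι : Type*) [Fintype ι] [DecidableEq ι] (M : ℤ) :
    ∃ B : ℝ, 0 ≤ B ∧ ∀ S : Matrix ι ι ℤ, (∀ i j, |S i j| ≤ M) →
      (∃ c : ι → ℤ, c ≠ 0 ∧ c ⬝ᵥ S *ᵥ c = 0) →
      ∃ c : ι → ℤ, c ≠ 0 ∧ c ⬝ᵥ S *ᵥ c = 0 ∧ ∑ i, |(c i : ℝ)| ≤ B := by
  classical
  let f : (ι → ι → ℤ) → ℝ := fun S =>
    -- Only finitely many integral matrices have bounded entries, so one isotropic vector is chosen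
    -- for each.
    if h : ∃ c : ι → ℤ, c ≠ 0 ∧ c ⬝ᵥ Matrix.of S *ᵥ c = 0 then ∑ i, |(h.choose i : ℝ)| else 0
  obtain ⟨B, hB⟩ := ((Set.finite_Icc (fun _ _ => -M : ι → ι → ℤ) fun _ _ => M).image f).bddAbove
  refine ⟨max B 0, le_max_right _ _, fun S hS h => ⟨h.choose, h.choose_spec.1, h.choose_spec.2, ?_⟩⟩
  refine le_max_of_le_left (hB ⟨S, ⟨fun i j => (abs_le.1 (hS i j)).1,
    fun i j => (abs_le.1 (hS i j)).2⟩, ?_⟩)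
  exact dif_pos h

theorem exists_linearIndependent_of_span_eq_top {ι : Type*} [Fintype ι] {s : Set (ι → ℝ)}
    (hs : Submodule.span ℝ s = ⊤) :
    ∃ y : ι → ι → ℝ, (∀ i, y i ∈ s) ∧ LinearIndependent ℝ y := by
  obtain ⟨f, hfs, -, hf⟩ := Submodule.exists_fun_fin_finrank_span_eq ℝ s
  have hcard : Fintype.card ι = Fintype.card (Fin (Module.finrank ℝ (Submodule.span ℝ s))) := by
    rw [hs, finrank_top, Fintype.card_fin, Module.finrank_fintype_fun_eq_card]
  let e := Fintype.equivOfCardEq hcard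
  exact ⟨f ∘ e, fun i => hfs _, hf.comp e e.injective⟩

/-- For an isotropic nondegenerate integral form, the real matrices `G` preserving the form have
the images of some integral isotropic vectors bounded uniformly in `G`. -/
theorem exists_short_isotropic {ι : Type*} [Fintype ι] [DecidableEq ι] (S : Matrix ι ι ℤ)
    (hS : S.det ≠ 0) {x₀ : ι → ℤ} (hx₀ : x₀ ≠ 0) (hSx₀ : x₀ ⬝ᵥ S *ᵥ x₀ = 0) :
    ∃ C : ℝ, ∀ G : Matrix ι ι ℝ, Gᵀ * realMat S * G = realMat S →
      ∃ x : ι → ℤ, x ≠ 0 ∧ x ⬝ᵥ S *ᵥ x = 0 ∧ ‖G *ᵥ realVec x‖ ≤ C := by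
  obtain ⟨K, hK0, hK⟩ := exists_abs_bilin_le (realMat S)
  let ε := (K + 1)⁻¹
  have hε : 0 < ε := by positivity
  have hε1 : ε ≤ 1 := inv_le_one_of_one_le₀ (by linarith)
  have hKε : K * ε < 1 := by
    rw [← div_eq_mul_inv, div_lt_one (by positivity)]
    linarith
  obtain ⟨R, hR0, hR⟩ := exists_span_short_eq_top ι hε
  obtain ⟨B, hB0, hB⟩ := exists_bounded_isotropic ι ⌈K * R * R⌉
  refine ⟨max 1 (B * R), fun G hG => ?_⟩
  have hform : ∀ x y : ι → ℤ, ((x ⬝ᵥ S *ᵥ y : ℤ) : ℝ)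
      = (G *ᵥ realVec x) ⬝ᵥ realMat S *ᵥ (G *ᵥ realVec y) := fun x y => by
    rw [mulVec_dotProduct_mulVec, hG, intCast_dotProduct, realVec_mulVec]
  -- Either no nonzero lattice vector is shorter than `ε`, and short vectors form a basis of the
  -- space in which the form has bounded integral coefficients; or a vector shorter than `ε` exists,
  -- and its integral form value is below 1 in absolute value, hence zero.
  by_cases hmin : ∀ x : ι → ℤ, x ≠ 0 → ε ≤ ‖G *ᵥ realVec x‖
  · have hdet : |G.det| = 1 := by
      have hSR : (realMat S).det ≠ 0 := by
        have : ((S.det : ℤ) : ℝ) = (realMat S).det := RingHom.map_det (Int.castRingHom ℝ) S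
        rw [← this]
        exact_mod_cast hS
      have := congrArg Matrix.det hG
      rw [det_mul, det_mul, det_transpose] at this
      have h2 : G.det * G.det = 1 := mul_right_cancel₀ hSR (by linarith)
      rcases mul_self_eq_one_iff.1 h2 with h | h <;> simp [h]
    obtain ⟨y, hy, hyind⟩ := exists_linearIndependent_of_span_eq_top (hR G hdet hmin)
    choose x hxy hyR using hy
    let X : Matrix ι ι ℤ := Matrix.of fun i j => x j i
    have hX : ∀ c : ι → ℤ, G *ᵥ realVec (X *ᵥ c) = ∑ i, (c i : ℝ) • y i := fun c => by
      have : realVec (X *ᵥ c) = ∑ i, (c i : ℝ) • realVec (x i) := by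
        ext j
        simp [realVec, X, mulVec, dotProduct, mul_comm]
      rw [this, mulVec_sum]
      exact Finset.sum_congr rfl fun i _ => by rw [mulVec_smul, hxy]
    have hXinj : ∀ c : ι → ℤ, X *ᵥ c = 0 → c = 0 := fun c hc => by
      have h0 : ∑ i, (c i : ℝ) • y i = 0 := by
        rw [← hX, hc]
        have : realVec (0 : ι → ℤ) = 0 := funext fun i => Int.cast_zero
        rw [this, mulVec_zero]
      exact funext fun i => by exact_mod_cast Fintype.linearIndependent_iff.1 hyind _ h0 i
    have hXdet : X.det ≠ 0 := fun h => by
      obtain ⟨c, hc0, hc⟩ := exists_mulVec_eq_zero_iff.2 h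
      exact hc0 (hXinj c hc)
    -- The columns of `X` may span only a sublattice. The adjugate still carries `x₀` into it up to
    -- the factor `det X`, so the restricted form stays isotropic.
    have hXc : X *ᵥ (X.adjugate *ᵥ x₀) = X.det • x₀ := by
      rw [mulVec_mulVec, mul_adjugate, smul_mulVec, one_mulVec]
    obtain ⟨c, hc0, hc, hcB⟩ := hB (Xᵀ * S * X)
      (fun i j => by
        have h1 : (Xᵀ * S * X) i j = x i ⬝ᵥ S *ᵥ x j := by
          rw [Matrix.mul_assoc, Matrix.mul_apply]
          rfl
        have h2 : |((x i ⬝ᵥ S *ᵥ x j : ℤ) : ℝ)| ≤ K * R * R := by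
          rw [hform, ← hxy, ← hxy]
          exact (hK _ _).trans (by gcongr <;> exact hyR _)
        rw [h1]
        exact_mod_cast h2.trans (Int.le_ceil _))
      ⟨X.adjugate *ᵥ x₀, fun h => by
        rw [h, mulVec_zero] at hXc
        exact smul_ne_zero hXdet hx₀ hXc.symm, by
        rw [← mulVec_dotProduct_mulVec, hXc, mulVec_smul, smul_dotProduct, dotProduct_smul, hSx₀,
          smul_zero, smul_zero]⟩
    refine ⟨X *ᵥ c, fun h => hc0 (hXinj c h), ?_, le_max_of_le_right ?_⟩
    · rw [mulVec_dotProduct_mulVec, hc]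
    · rw [hX]
      calc _ ≤ ∑ i, ‖(c i : ℝ) • y i‖ := norm_sum_le _ _
        _ ≤ ∑ i, |(c i : ℝ)| * R := Finset.sum_le_sum fun i _ => by
            rw [norm_smul, Real.norm_eq_abs]
            gcongr
            exact hyR i
        _ ≤ B * R := by
            rw [← Finset.sum_mul]
            gcongr
  · push Not at hmin
    obtain ⟨x, hx0, hx⟩ := hmin
    refine ⟨x, hx0, ?_, (hx.le.trans hε1).trans (le_max_left _ _)⟩
    have h1 : |((x ⬝ᵥ S *ᵥ x : ℤ) : ℝ)| < 1 := by
      rw [hform]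
      calc _ ≤ K * ‖G *ᵥ realVec x‖ * ‖G *ᵥ realVec x‖ := hK _ _
        _ ≤ K * ε * 1 := by
            gcongr
            exact hx.le.trans hε1
        _ < 1 := by linarith
    exact Int.abs_lt_one_iff.1 (by exact_mod_cast h1)

end Isotropic

/-! ### The Hermitian form and its real coordinates -/

namespace Siegel

open Matrix ComplexConjugate

variable {n : ℕ}

/-- The coordinates of `ℂⁿ⁺²`: the summand `Fin n` indexes the numerators `r`, while `Sum.inr 0`
and `Sum.inr 1` index the denominator `q` and the numerator `p`. -/
abbrev Coord (n : ℕ) : Type := Fin n ⊕ Fin 2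

/-- Identification of real and complex coordinates. -/
def complexCoord {κ : Type*} : (κ × Fin 2 → ℝ) ≃ₗ[ℝ] (κ → ℂ) where
  toFun x k := ⟨x (k, 0), x (k, 1)⟩
  invFun z k := ![(z k.1).re, (z k.1).im] k.2
  map_add' _ _ := rfl
  map_smul' c x := funext fun k => Complex.ext (by simp) (by simp)
  left_inv x := by
    ext ⟨k, a⟩
    fin_cases a <;> rfl
  right_inv _ := rfl

theorem complexCoord_apply {κ : Type*} (x : κ × Fin 2 → ℝ) (k : κ) :
    complexCoord x k = ⟨x (k, 0), x (k, 1)⟩ := rfl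

/-- The action on `ℂⁿ⁺²` of left translation by `h⁻¹` followed by a dilation. -/
noncomputable def transform (h : Siegel n) (T : ℝ) : (Coord n → ℂ) →ₗ[ℂ] (Coord n → ℂ) where
  toFun z := Sum.elim (fun i => z (Sum.inl i) - z (Sum.inr 0) * h.u i)
    ![(T : ℂ)⁻¹ * z (Sum.inr 0),
      T * (z (Sum.inr 1) + z (Sum.inr 0) * star h.v - ∑ i, star (h.u i) * z (Sum.inl i))]
  map_add' z w := by
    ext (i | k)
    · simp only [Pi.add_apply, Sum.elim_inl]
      ring
    · fin_cases k
      · simp [mul_add]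
      · simp only [Fin.mk_one, Pi.add_apply, Sum.elim_inr, cons_val_one, mul_add,
          Finset.sum_add_distrib, cons_val_fin_one]
        ring
  map_smul' c z := by
    ext (i | k)
    · simp only [Pi.smul_apply, Sum.elim_inl, smul_eq_mul, RingHom.id_apply]
      ring
    · fin_cases k
      · simp [mul_left_comm]
      · simp only [Fin.mk_one, Pi.smul_apply, Sum.elim_inr, cons_val_one, smul_eq_mul,
          RingHom.id_apply, cons_val_fin_one, mul_left_comm _ c, ← Finset.mul_sum]
        ring

/-- The Hermitian form `q̄ p' + p̄ q' - ⟨r, r'⟩` on `ℂⁿ⁺²`. -/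
def hermForm (z w : Coord n → ℂ) : ℂ :=
  star (z (Sum.inr 0)) * w (Sum.inr 1) + star (z (Sum.inr 1)) * w (Sum.inr 0)
    - ∑ i, star (z (Sum.inl i)) * w (Sum.inl i)

/-- The dilation factors `T⁻¹` and `T` cancel in the pairing of `q` with `p`; the remaining terms
cancel by `‖u‖² = v + v̄`. -/
theorem hermForm_transform (h : Siegel n) {T : ℝ} (hT : T ≠ 0) (z w : Coord n → ℂ) :
    hermForm (transform h T z) (transform h T w) = hermForm z w := by
  have hT' : (T : ℂ) ≠ 0 := by exact_mod_cast hT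
  have e : ∀ i, star (z (Sum.inl i) - z (Sum.inr 0) * h.u i)
        * (w (Sum.inl i) - w (Sum.inr 0) * h.u i)
      = star (z (Sum.inl i)) * w (Sum.inl i)
        - star (z (Sum.inr 0)) * (star (h.u i) * w (Sum.inl i))
        - w (Sum.inr 0) * (star (z (Sum.inl i)) * h.u i)
        + star (z (Sum.inr 0)) * w (Sum.inr 0) * (star (h.u i) * h.u i) := fun i => by
    rw [star_sub, star_mul']
    ring
  simp only [hermForm, transform, LinearMap.coe_mk, AddHom.coe_mk, Sum.elim_inl, Sum.elim_inr,
    cons_val_zero, cons_val_one, cons_val_fin_one]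
  rw [Finset.sum_congr rfl fun i _ => e i, Finset.sum_add_distrib, Finset.sum_sub_distrib,
    Finset.sum_sub_distrib, ← Finset.mul_sum, ← Finset.mul_sum, ← Finset.mul_sum,
    h.star_mul_self_eq]
  simp only [star_mul', star_sub, star_add, star_sum, star_inv₀, Complex.star_def,
    Complex.conj_ofReal, Complex.conj_conj]
  have e2 : ∀ i, h.u i * conj (z (Sum.inl i)) = conj (z (Sum.inl i)) * h.u i :=
    fun i => mul_comm _ _
  simp only [e2]
  field_simp
  ring

/-- The involution of the real coordinates that exchanges `q` and `p`. -/
def swapIdx : Coord n × Fin 2 → Coord n × Fin 2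
  | (Sum.inl i, a) => (Sum.inl i, a)
  | (Sum.inr k, a) => (Sum.inr (1 - k), a)

/-- The sign of a real coordinate in the Hermitian form. -/
def signIdx : Coord n × Fin 2 → ℤ
  | (Sum.inl _, _) => -1
  | (Sum.inr _, _) => 1

/-- The Gram matrix of the real part of the Hermitian form. -/
def gram (n : ℕ) : Matrix (Coord n × Fin 2) (Coord n × Fin 2) ℤ :=
  Matrix.of fun x y => if swapIdx x = y then signIdx x else 0

theorem gram_mulVec (x : Coord n × Fin 2 → ℤ) :
    gram n *ᵥ x = fun k => signIdx k * x (swapIdx k) := by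
  ext k
  simp [gram, mulVec, dotProduct]

theorem realMat_gram_mulVec (x : Coord n × Fin 2 → ℝ) :
    realMat (gram n) *ᵥ x = fun k => signIdx k * x (swapIdx k) := by
  ext k
  simp [gram, realMat, mulVec, dotProduct]

theorem gram_mul_gram : gram n * gram n = 1 := by
  refine Matrix.ext_of_mulVec_single fun j => ?_
  rw [← mulVec_mulVec, gram_mulVec, gram_mulVec, one_mulVec]
  ext ⟨i | k, a⟩
  · simp [signIdx, swapIdx]
  · simp [signIdx, swapIdx]

theorem det_gram_ne_zero : (gram n).det ≠ 0 := fun h => by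
  have := congrArg Matrix.det (gram_mul_gram (n := n))
  rw [det_mul, h, det_one] at this
  simp at this

theorem dotProduct_gram (x y : Coord n × Fin 2 → ℝ) :
    x ⬝ᵥ realMat (gram n) *ᵥ y = (hermForm (complexCoord x) (complexCoord y)).re := by
  rw [realMat_gram_mulVec]
  simp only [dotProduct, Fintype.sum_prod_type, Fintype.sum_sum_type, Fin.sum_univ_two, signIdx,
    swapIdx, hermForm, complexCoord_apply,
    Complex.sub_re, Complex.add_re, Complex.re_sum, Complex.mul_re, Complex.star_def,
    Complex.conj_re, Complex.conj_im]
  have : (1 : Fin 2) - 1 = 0 := rfl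
  simp only [sub_zero, this, sub_eq_add_neg _ (∑ i, _), ← Finset.sum_neg_distrib]
  rw [add_comm]
  push_cast
  congr 1
  · ring
  · exact Finset.sum_congr rfl fun i _ => by ring

end Siegel

/-! ### Dirichlet's theorem -/

namespace Siegel

open Matrix ComplexConjugate

variable {n : ℕ}

/-- The real matrix of `transform h T`. -/
noncomputable def transformMatrix (h : Siegel n) (T : ℝ) :
    Matrix (Coord n × Fin 2) (Coord n × Fin 2) ℝ :=
  LinearMap.toMatrix' (complexCoord.symm.toLinearMap ∘ₗ
    (transform h T).restrictScalars ℝ ∘ₗ complexCoord.toLinearMap)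

theorem complexCoord_transformMatrix_mulVec (h : Siegel n) (T : ℝ) (x : Coord n × Fin 2 → ℝ) :
    complexCoord (transformMatrix h T *ᵥ x) = transform h T (complexCoord x) := by
  simp [transformMatrix, LinearMap.toMatrix'_mulVec]

theorem transformMatrix_gram (h : Siegel n) {T : ℝ} (hT : T ≠ 0) :
    (transformMatrix h T)ᵀ * realMat (gram n) * transformMatrix h T = realMat (gram n) := by
  have key : ∀ x y, x ⬝ᵥ ((transformMatrix h T)ᵀ * realMat (gram n) * transformMatrix h T) *ᵥ y
      = x ⬝ᵥ realMat (gram n) *ᵥ y := fun x y => by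
    rw [← mulVec_dotProduct_mulVec, dotProduct_gram, dotProduct_gram,
      complexCoord_transformMatrix_mulVec, complexCoord_transformMatrix_mulVec,
      hermForm_transform h hT]
  ext i j
  simpa using key (Pi.single i 1) (Pi.single j 1)

theorem IsDenominator.mem_rationalPoints {y : Siegel n} {q : GaussianInt}
    (hy : y.IsDenominator q) : y ∈ rationalPoints n := by
  have key : ∀ r : GaussianInt, ∃ a b : ℚ,
      (r : ℂ) / (q : ℂ) = (a : ℂ) + (b : ℂ) * Complex.I := fun r => by
    refine ⟨(r.re * q.re + r.im * q.im) / (q.re * q.re + q.im * q.im),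
      (r.im * q.re - r.re * q.im) / (q.re * q.re + q.im * q.im), ?_⟩
    have hab : ∀ a b : ℚ, (a : ℂ) + (b : ℂ) * Complex.I = ⟨a, b⟩ := fun a b => by
      apply Complex.ext <;> simp
    rw [hab, GaussianInt.toComplex_def₂, GaussianInt.toComplex_def₂]
    apply Complex.ext
    · rw [Complex.div_re, Complex.normSq_mk]
      push_cast
      ring
    · rw [Complex.div_im, Complex.normSq_mk]
      push_cast
      ring
  obtain ⟨-, hr, p, hp⟩ := hy
  refine ⟨fun i => ?_, ?_⟩
  · obtain ⟨r, hr⟩ := hr i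
    exact hr ▸ key r
  · exact hp ▸ key p

/-- An isotropic integral vector with nonzero denominator defines a rational point. -/
noncomputable def ofIsotropic (q p : GaussianInt) (r : Fin n → GaussianInt) (hq : q ≠ 0)
    (h : 2 * ((p : ℂ) * star (q : ℂ)).re = ∑ i, ‖(r i : ℂ)‖ ^ 2) : Siegel n where
  u i := (r i : ℂ) / (q : ℂ)
  v := (p : ℂ) / (q : ℂ)
  two_mul_re := by
    have hq' : (q : ℂ) ≠ 0 := fun h => hq (GaussianInt.toComplex_eq_zero.1 h)
    have e : (p : ℂ) / (q : ℂ) = ((‖(q : ℂ)‖ ^ 2)⁻¹ : ℝ) * ((p : ℂ) * star (q : ℂ)) := by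
      rw [Complex.star_def, Complex.ofReal_inv, Complex.ofReal_pow, ← Complex.mul_conj']
      have : conj (q : ℂ) ≠ 0 := by simpa using hq'
      field_simp
    rw [e, Complex.re_ofReal_mul]
    simp only [norm_div, div_pow, ← Finset.sum_div]
    rw [← h]
    ring

/-- **Dirichlet's theorem** for the Siegel model. -/
theorem exists_denominator_dist_le (n : ℕ) : ∃ C : ℝ, 0 < C ∧ ∀ (h : Siegel n) (T : ℝ), C < T →
    ∃ (y : Siegel n) (q : GaussianInt), y.IsDenominator q ∧ ‖(q : ℂ)‖ ≤ C * T ∧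
      dist h y ^ 2 ≤ C / (T * ‖(q : ℂ)‖) := by
  -- The vector `q = 1`, `r = p = 0` is isotropic, since `q` pairs only with `p`.
  have hx₀ : (Pi.single (Sum.inr 0, 0) 1 : Coord n × Fin 2 → ℤ) ≠ 0 :=
    Pi.single_ne_zero_iff.2 one_ne_zero
  obtain ⟨C, hC⟩ := exists_short_isotropic (gram n) det_gram_ne_zero hx₀
    (by simp [gram, swapIdx])
  -- The factor 2 passes from real coordinates to complex norms.
  refine ⟨2 * max C 1, by positivity, fun h T hT => ?_⟩
  have hC1 : 1 ≤ max C 1 := le_max_right _ _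
  have hT0 : 0 < T := by linarith
  obtain ⟨x, hx0, hSx, hx⟩ := hC _ (transformMatrix_gram h hT0.ne')
  set z := complexCoord (realVec x) with hz
  let g : Coord n → GaussianInt := fun k => ⟨x (k, 0), x (k, 1)⟩
  have hg : ∀ k, (g k : ℂ) = z k := fun k => by
    apply Complex.ext <;> simp [g, hz, complexCoord_apply, realVec]
  have hnorm : ∀ k, ‖transform h T z k‖ ≤ 2 * max C 1 := fun k => by
    rw [hz, ← complexCoord_transformMatrix_mulVec, complexCoord_apply]
    refine (Complex.norm_le_abs_re_add_abs_im _).trans ?_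
    rw [two_mul]
    exact add_le_add (((norm_le_pi_norm _ _).trans hx).trans (le_max_left _ _))
      (((norm_le_pi_norm _ _).trans hx).trans (le_max_left _ _))
  have hiso : 2 * (z (Sum.inr 1) * star (z (Sum.inr 0))).re = ∑ i, ‖z (Sum.inl i)‖ ^ 2 := by
    have h1 : (hermForm z z).re = 0 := by
      rw [hz, ← dotProduct_gram, ← realVec_mulVec, ← intCast_dotProduct, hSx, Int.cast_zero]
    have h2 : ∀ i, (star (z (Sum.inl i)) * z (Sum.inl i)).re = ‖z (Sum.inl i)‖ ^ 2 := fun i => by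
      rw [← Complex.normSq_eq_norm_sq, Complex.normSq_apply]
      simp
    simp only [hermForm, Complex.sub_re, Complex.re_sum, h2] at h1
    rw [← sub_eq_zero.1 h1]
    simp
    ring
  -- If `q = 0`, isotropy forces `r = 0`; then `T|p|` is at most the constant, which is below `T`,
  -- so the Gaussian integer `p` vanishes too.
  have hq0 : z (Sum.inr 0) ≠ 0 := fun hq => by
    have hr : ∀ i, z (Sum.inl i) = 0 := fun i => by
      rw [hq, star_zero, mul_zero, Complex.zero_re, mul_zero, eq_comm,
        Finset.sum_eq_zero_iff_of_nonneg fun _ _ => by positivity] at hiso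
      simpa using hiso i (Finset.mem_univ i)
    have hp : ‖z (Sum.inr 1)‖ < 1 := by
      have := hnorm (Sum.inr 1)
      simp only [transform, LinearMap.coe_mk, AddHom.coe_mk, Sum.elim_inr, cons_val_one,
        cons_val_fin_one, hr, hq, mul_zero, zero_mul, add_zero, Finset.sum_const_zero, sub_zero,
        norm_mul, Complex.norm_real, Real.norm_of_nonneg hT0.le] at this
      by_contra! hge
      nlinarith
    have hp0 : z (Sum.inr 1) = 0 := by
      rw [← hg, GaussianInt.toComplex_eq_zero, Zsqrtd.ext_iff]
      rw [← hg] at hp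
      constructor
      · have := (Complex.abs_re_le_norm _).trans_lt hp
        rw [← GaussianInt.intCast_re] at this
        exact Int.abs_lt_one_iff.1 (by exact_mod_cast this)
      · have := (Complex.abs_im_le_norm _).trans_lt hp
        rw [← GaussianInt.intCast_im] at this
        exact Int.abs_lt_one_iff.1 (by exact_mod_cast this)
    have hz0 : z = 0 := by
      ext (i | k)
      · exact hr i
      · fin_cases k
        · exact hq
        · exact hp0
    have hx : realVec x = 0 := complexCoord.map_eq_zero_iff.1 hz0
    exact hx0 (funext fun k => Int.cast_eq_zero.1 (congrFun hx k))
  have hgq : g (Sum.inr 0) ≠ 0 := fun h => hq0 (by rw [← hg, h, GaussianInt.toComplex_zero])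
  let y := ofIsotropic (g (Sum.inr 0)) (g (Sum.inr 1)) (fun i => g (Sum.inl i)) hgq
    (by simpa only [hg] using hiso)
  refine ⟨y, g (Sum.inr 0), ⟨hgq, fun i => ⟨_, rfl⟩, ⟨_, rfl⟩⟩, ?_, ?_⟩
  · have := hnorm (Sum.inr 0)
    simp only [transform, LinearMap.coe_mk, AddHom.coe_mk, Sum.elim_inr, cons_val_zero, norm_mul,
      norm_inv, Complex.norm_real, Real.norm_of_nonneg hT0.le] at this
    rw [hg]
    rwa [inv_mul_le_iff₀ hT0, mul_comm] at this
  · have hv : (h⁻¹ * y).v * (T * z (Sum.inr 0)) = transform h T z (Sum.inr 1) := by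
      simp only [mul_v, inv_u, inv_v, transform, LinearMap.coe_mk, AddHom.coe_mk, Sum.elim_inr,
        cons_val_one, cons_val_fin_one, y, ofIsotropic, hg, star_neg, neg_mul,
        Finset.sum_neg_distrib, ← mul_div_assoc, ← Finset.sum_div]
      field_simp
      ring
    have := hnorm (Sum.inr 1)
    rw [← hv, norm_mul, norm_mul, Complex.norm_real, Real.norm_of_nonneg hT0.le] at this
    rw [dist_sq, hg, le_div_iff₀ (mul_pos hT0 (norm_pos_iff.2 hq0))]
    exact this

end Siegel

/-! ### Volumes of balls and the doubling property -/

namespace Siegel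

variable {n : ℕ}

theorem continuous_v : Continuous fun h : Siegel n => h.v :=
  continuous_snd.comp continuous_toProd

theorem volume_apply {s : Set (Siegel n)} (hs : MeasurableSet s) :
    volume s = volume (ofCoord ⁻¹' s) := Measure.map_apply measurable_ofCoord hs

theorem volume_closedBall_eq (g : Siegel n) (r : ℝ) :
    volume (Metric.closedBall g r) = volume (Metric.closedBall (1 : Siegel n) r) := by
  let c : (Fin n → ℂ) → ℝ := fun u => g.v.im + (∑ i, star (g.u i) * u i).im
  have hc : Continuous c := by fun_prop
  -- In coordinates, left translation by `g` is a translation in `u` and, for fixed `u`, a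
  -- translation in `t`.
  have hφ : MeasurePreserving (fun p : (Fin n → ℂ) × ℝ => (g.u + p.1, c p.1 + p.2)) := by
    refine MeasurePreserving.skew_product (g := fun u t => c u + t)
      (measurePreserving_add_left volume g.u) (by fun_prop) (Eventually.of_forall fun u => ?_)
    exact (measurePreserving_add_left volume (c u)).map_eq
  have hof : ∀ p : (Fin n → ℂ) × ℝ, ofCoord (g.u + p.1, c p.1 + p.2) = g * ofCoord p :=
    fun p => by
    obtain ⟨q, hq⟩ := ofCoord_bijective.2 (g * ofCoord p)
    rw [← hq]
    congr 1
    refine Prod.ext ?_ ?_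
    · exact (congrArg Siegel.u hq).symm
    · have := congrArg (fun h => h.v.im) hq
      simp only [mul_v, Complex.add_im] at this
      simp only [c]
      simp only [ofCoord] at this
      linarith
  rw [volume_apply measurableSet_closedBall, volume_apply measurableSet_closedBall,
    ← hφ.measure_preimage (measurable_ofCoord measurableSet_closedBall).nullMeasurableSet]
  congr 1
  ext p
  simp only [Set.mem_preimage, hof, Metric.mem_closedBall]
  conv_lhs => rw [← mul_one g, mul_assoc, one_mul, dist_mul_left]

theorem mem_closedBall_one {r : ℝ} (hr : 0 ≤ r) {h : Siegel n} :
    h ∈ Metric.closedBall 1 r ↔ ‖h.v‖ ≤ r ^ 2 := by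
  rw [Metric.mem_closedBall, dist_comm, ← abs_of_nonneg (dist_nonneg (x := (1 : Siegel n))),
    ← sq_le_sq₀ (abs_nonneg _) hr, sq_abs, dist_sq]
  simp

/-- Balls of radius `r` have measure comparable to a fixed power of `r`. -/
theorem exists_volume_closedBall_bounds (n : ℕ) : ∃ (N : ℕ) (c C : ℝ), N ≠ 0 ∧ 0 < c ∧ 0 < C ∧
    ∀ (x : Siegel n) (r : ℝ), 0 ≤ r → ENNReal.ofReal (c * r ^ N) ≤ volume (Metric.closedBall x r) ∧
      volume (Metric.closedBall x r) ≤ ENNReal.ofReal (C * r ^ N) := by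
  set d := Module.finrank ℝ (Fin n → ℂ)
  set β := (volume (Metric.ball (0 : Fin n → ℂ) 1)).toReal with hβ
  have hβtop : volume (Metric.ball (0 : Fin n → ℂ) 1) ≠ ⊤ := measure_ball_lt_top.ne
  have hβ0 : 0 < β :=
    ENNReal.toReal_pos (Metric.measure_ball_pos volume _ one_pos).ne' hβtop
  have hbox : ∀ a b : ℝ, 0 ≤ a → 0 ≤ b →
      volume (Metric.closedBall (0 : Fin n → ℂ) a ×ˢ Metric.closedBall (0 : ℝ) b)
        = ENNReal.ofReal (a ^ d * β * (2 * b)) := fun a b ha hb => by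
    rw [Measure.volume_eq_prod, Measure.prod_prod, Measure.addHaar_closedBall _ _ ha,
      Real.volume_closedBall, ENNReal.ofReal_mul (p := a ^ d * β) (by positivity),
      ENNReal.ofReal_mul (p := a ^ d) (by positivity), hβ, ENNReal.ofReal_toReal hβtop]
  -- The exponent is the homogeneous dimension: `t` scales as `r ^ 2`. The ball lies between boxes;
  -- the factor `1 / (n + 1)` keeps `∑ ‖uᵢ‖²` below `r ^ 2` inside the smaller one.
  refine ⟨d + 2, ((n + 1 : ℝ)⁻¹) ^ d * β, 2 ^ d * β * 2, by omega, by positivity, by positivity,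
    fun x r hr => ?_⟩
  rw [volume_closedBall_eq, volume_apply measurableSet_closedBall]
  constructor
  · have e : ((n + 1 : ℝ)⁻¹) ^ d * β * r ^ (d + 2)
        = ((n + 1 : ℝ)⁻¹ * r) ^ d * β * (2 * (r ^ 2 / 2)) := by
      rw [mul_pow]
      ring
    rw [e, ← hbox _ _ (by positivity) (by positivity)]
    refine measure_mono fun p hp => ?_
    rw [Set.mem_prod, mem_closedBall_zero_iff, mem_closedBall_zero_iff] at hp
    rw [Set.mem_preimage, mem_closedBall_one hr]
    have hsum : ∑ i, ‖p.1 i‖ ^ 2 ≤ r ^ 2 := by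
      calc ∑ i, ‖p.1 i‖ ^ 2 ≤ ∑ _i : Fin n, ((n + 1 : ℝ)⁻¹ * r) ^ 2 :=
            Finset.sum_le_sum fun i _ => by
              gcongr
              exact (norm_le_pi_norm _ _).trans hp.1
        _ = (n * (n + 1 : ℝ)⁻¹) * (n + 1 : ℝ)⁻¹ * r ^ 2 := by
            simp
            ring
        _ ≤ 1 * 1 * r ^ 2 := by
            gcongr
            · rw [← div_eq_mul_inv]
              exact div_le_one_of_le₀ (by linarith) (by positivity)
            · exact inv_le_one_of_one_le₀ (by linarith [n.cast_nonneg (α := ℝ)])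
        _ = _ := by ring
    refine (Complex.norm_le_abs_re_add_abs_im _).trans ?_
    have h2 : |(ofCoord p).v.re| ≤ r ^ 2 / 2 := by
      simp only [ofCoord]
      rw [abs_of_nonneg (by positivity)]
      linarith
    have h3 : |(ofCoord p).v.im| ≤ r ^ 2 / 2 := hp.2
    linarith
  · have e : 2 ^ d * β * 2 * r ^ (d + 2) = (2 * r) ^ d * β * (2 * r ^ 2) := by
      rw [mul_pow]
      ring
    rw [e, ← hbox _ _ (by positivity) (by positivity)]
    refine measure_mono fun p hp => ?_
    rw [Set.mem_preimage, mem_closedBall_one hr] at hp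
    rw [Set.mem_prod, mem_closedBall_zero_iff, mem_closedBall_zero_iff]
    refine ⟨(pi_norm_le_iff_of_nonneg (by positivity)).2 fun i => ?_, ?_⟩
    · refine (norm_u_le (ofCoord p) i).trans ?_
      gcongr
      exact Real.sqrt_le_iff.2 ⟨hr, hp⟩
    · exact (Complex.abs_im_le_norm (ofCoord p).v).trans hp

instance : IsLocallyFiniteMeasure (volume : Measure (Siegel n)) := ⟨fun x => by
  obtain ⟨N, c, C, -, -, -, h⟩ := exists_volume_closedBall_bounds n
  exact ⟨_, Metric.closedBall_mem_nhds x one_pos,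
    (h x 1 zero_le_one).2.trans_lt ENNReal.ofReal_lt_top⟩⟩

instance : IsUnifLocDoublingMeasure (volume : Measure (Siegel n)) := ⟨by
  obtain ⟨N, c, C, -, hc, hC, h⟩ := exists_volume_closedBall_bounds n
  refine ⟨(C * 2 ^ N / c).toNNReal, eventually_nhdsWithin_of_forall fun ε hε x => ?_⟩
  have hε : 0 < ε := hε
  refine (h x (2 * ε) (by positivity)).2.trans ?_
  calc ENNReal.ofReal (C * (2 * ε) ^ N)
      = ENNReal.ofReal (C * 2 ^ N / c) * ENNReal.ofReal (c * ε ^ N) := by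
        rw [← ENNReal.ofReal_mul (by positivity), mul_pow]
        congr 1
        field_simp
    _ ≤ _ := by
        gcongr
        · exact le_rfl
        · exact (h x ε hε.le).1⟩

theorem ae_irrational_im_v : ∀ᵐ h : Siegel n, Irrational h.v.im := by
  have hm : MeasurableSet {h : Siegel n | Irrational h.v.im} := by
    have : Measurable fun h : Siegel n => h.v.im :=
      (Complex.continuous_im.comp continuous_v).measurable
    exact this (Set.countable_range _).measurableSet.compl
  refine (ae_map_iff measurable_ofCoord.aemeasurable hm).2 ?_
  have : ∀ᵐ t : ℝ, Irrational t := (Set.countable_range ((↑) : ℚ → ℝ)).ae_notMem volume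
  exact Measure.quasiMeasurePreserving_snd.ae this

end Siegel

/-! ### Denominators, heights and repulsion -/

namespace Siegel

open ComplexConjugate

variable {n : ℕ}

theorem one_le_norm_gaussianInt {m : GaussianInt} (hm : m ≠ 0) : 1 ≤ ‖(m : ℂ)‖ := by
  have h1 : (1 : ℝ) ≤ (m.norm : ℝ) := by exact_mod_cast GaussianInt.norm_pos.2 hm
  rw [GaussianInt.intCast_real_norm, Complex.normSq_eq_norm_sq] at h1
  exact (one_le_sq_iff₀ (norm_nonneg _)).1 h1

theorem exists_isDenominator {y : Siegel n} (hy : y ∈ rationalPoints n) :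
    ∃ q, y.IsDenominator q := by
  obtain ⟨hu, a, b, hab⟩ := hy
  choose c d hcd using hu
  let D : ℕ := (∏ i, (c i).den * (d i).den) * (a.den * b.den)
  have hD : D ≠ 0 := by
    refine mul_ne_zero (Finset.prod_ne_zero_iff.2 fun i _ => ?_) ?_ <;>
    exact mul_ne_zero (Rat.den_ne_zero _) (Rat.den_ne_zero _)
  have key : ∀ s : ℚ, s.den ∣ D → ∃ m : ℤ, (s : ℂ) = m / D := fun s ⟨k, hk⟩ => by
    refine ⟨s.num * k, ?_⟩
    have hk0 : (k : ℂ) ≠ 0 := by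
      rintro h
      rw [Nat.cast_eq_zero.1 h, mul_zero] at hk
      exact hD hk
    rw [hk]
    push_cast
    rw [mul_div_mul_right _ _ hk0, Rat.cast_def]
  have key2 : ∀ s t : ℚ, s.den ∣ D → t.den ∣ D → ∃ m : GaussianInt,
      (s : ℂ) + (t : ℂ) * Complex.I = (m : ℂ) / ((D : GaussianInt) : ℂ) := fun s t hs ht => by
    obtain ⟨k, hk⟩ := key s hs
    obtain ⟨l, hl⟩ := key t ht
    refine ⟨⟨k, l⟩, ?_⟩
    rw [hk, hl, GaussianInt.toComplex_def', map_natCast]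
    ring
  refine ⟨D, by exact_mod_cast hD, fun i => ?_, ?_⟩
  · have h1 : (c i).den * (d i).den ∣ D :=
      (Finset.dvd_prod_of_mem _ (Finset.mem_univ i)).trans (Dvd.intro _ rfl)
    rw [hcd]
    exact key2 _ _ ((Dvd.intro _ rfl).trans h1) ((Dvd.intro_left _ rfl).trans h1)
  · rw [hab]
    exact key2 _ _ ((Dvd.intro _ rfl).trans (Dvd.intro_left _ rfl))
      ((Dvd.intro_left _ rfl).trans (Dvd.intro_left _ rfl))

theorem IsDenominator.height_le {y : Siegel n} {q : GaussianInt} (h : y.IsDenominator q) :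
    y.height ≤ ‖(q : ℂ)‖ :=
  csInf_le ⟨0, by rintro _ ⟨q, -, rfl⟩; exact norm_nonneg _⟩ ⟨q, h, rfl⟩

/-- The infimum is attained because Gaussian norms are natural numbers. -/
theorem exists_isDenominator_height {y : Siegel n} (hy : y ∈ rationalPoints n) :
    ∃ q, y.IsDenominator q ∧ y.height = ‖(q : ℂ)‖ := by
  obtain ⟨q, hq, hmin⟩ := (measure fun q : GaussianInt => q.norm.natAbs).wf.has_min
    {q | y.IsDenominator q} (exists_isDenominator hy)
  refine ⟨q, hq, IsLeast.csInf_eq ⟨⟨q, hq, rfl⟩, ?_⟩⟩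
  rintro _ ⟨q', hq', rfl⟩
  have h1 : q.norm.natAbs ≤ q'.norm.natAbs := not_lt.1 (hmin q' hq')
  have h2 : (q.norm : ℝ) ≤ q'.norm := by
    rw [← GaussianInt.abs_natCast_norm q, ← GaussianInt.abs_natCast_norm q']
    exact_mod_cast h1
  rw [GaussianInt.intCast_real_norm, GaussianInt.intCast_real_norm, Complex.normSq_eq_norm_sq,
    Complex.normSq_eq_norm_sq] at h2
  exact le_of_sq_le_sq h2 (norm_nonneg _)

theorem one_le_height {y : Siegel n} (hy : y ∈ rationalPoints n) : 1 ≤ y.height := by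
  obtain ⟨q, hq, h⟩ := exists_isDenominator_height hy
  exact h ▸ one_le_norm_gaussianInt hq.1

/-- Distinct rational points repel each other. -/
theorem IsDenominator.one_le_dist_sq_mul {y y' : Siegel n} {q q' : GaussianInt}
    (h : y.IsDenominator q) (h' : y'.IsDenominator q') (hne : y ≠ y') :
    1 ≤ dist y y' ^ 2 * (‖(q : ℂ)‖ * ‖(q' : ℂ)‖) := by
  obtain ⟨hq, hr, p, hp⟩ := h
  obtain ⟨hq', hr', p', hp'⟩ := h'
  choose r hr using hr
  choose r' hr' using hr'
  have hqc : (q : ℂ) ≠ 0 := fun h => hq (GaussianInt.toComplex_eq_zero.1 h)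
  have hqc' : (q' : ℂ) ≠ 0 := fun h => hq' (GaussianInt.toComplex_eq_zero.1 h)
  have hcq : conj (q : ℂ) ≠ 0 := by simpa using hqc
  -- The numerator of `(y⁻¹ * y').v` over `q̄q'`. It is nonzero, since `v = 0` forces the identity
  -- element.
  let m : GaussianInt := star p * q' + p' * star q - ∑ i, star (r i) * r' i
  have hm : (y⁻¹ * y').v * (conj (q : ℂ) * q') = m := by
    have e : ∀ i, star (y⁻¹.u i) * y'.u i
        = -(conj (r i : ℂ) * (r' i : ℂ) / (conj (q : ℂ) * q')) := fun i => by
      rw [inv_u, hr, hr', star_neg, Complex.star_def, map_div₀, neg_mul, div_mul_div_comm]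
    rw [mul_v, Finset.sum_congr rfl fun i _ => e i, Finset.sum_neg_distrib, ← Finset.sum_div,
      inv_v, hp, hp']
    simp only [m, Complex.star_def, map_div₀, map_sub, map_add, map_mul, map_sum,
      GaussianInt.toComplex_star]
    field_simp
    ring
  have hm0 : m ≠ 0 := fun h => by
    rw [h, GaussianInt.toComplex_zero, mul_eq_zero, or_iff_left (mul_ne_zero hcq hqc')] at hm
    exact hne (inv_mul_eq_one.1 (eq_one_of_v_eq_zero hm))
  rw [dist_sq, ← Complex.norm_conj (q : ℂ), ← norm_mul, ← norm_mul, hm]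
  exact one_le_norm_gaussianInt hm0

end Siegel

/-! ### The divergence case -/

namespace Siegel

open ComplexConjugate

variable {n : ℕ}

/-- The points having a denominator `q` with `|q|² = i`. -/
def pointsOfNormSq (n i : ℕ) : Set (Siegel n) :=
  {y | ∃ q : GaussianInt, y.IsDenominator q ∧ ‖(q : ℂ)‖ ^ 2 = i}

theorem IsDenominator.mem_pointsOfNormSq {y : Siegel n} {q : GaussianInt}
    (h : y.IsDenominator q) : y ∈ pointsOfNormSq n q.norm.natAbs := by
  refine ⟨q, h, ?_⟩
  rw [GaussianInt.natCast_natAbs_norm, GaussianInt.intCast_real_norm, Complex.normSq_eq_norm_sq]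

theorem exists_natCast_mul_im_v_eq {y : Siegel n} {i : ℕ} (hy : y ∈ pointsOfNormSq n i) :
    ∃ m : ℤ, (i : ℝ) * y.v.im = m := by
  obtain ⟨q, ⟨hq, -, p, hp⟩, hi⟩ := hy
  have hqc : (q : ℂ) ≠ 0 := fun h => hq (GaussianInt.toComplex_eq_zero.1 h)
  have e : ((i : ℝ) : ℂ) * y.v = ((p * star q : GaussianInt) : ℂ) := by
    rw [← hi, hp, Complex.ofReal_pow, ← Complex.conj_mul', map_mul, GaussianInt.toComplex_star]
    field_simp
  refine ⟨(p * star q).im, ?_⟩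
  rw [GaussianInt.intCast_im, ← e, Complex.im_ofReal_mul]

/-- Every point whose coordinate `Im v` is irrational is approximated infinitely often, up to a constant
that depends only on the dimension. -/
theorem exists_frequently_mem_thickening (n : ℕ) : ∃ C : ℝ, 0 < C ∧ ∀ h : Siegel n,
    Irrational h.v.im →
      ∃ᶠ i : ℕ in atTop, h ∈ Metric.thickening (C * (√i)⁻¹) (pointsOfNormSq n i) := by
  obtain ⟨C, hC0, hC⟩ := exists_denominator_dist_le n
  refine ⟨C + 1, by positivity, fun h hirr => frequently_atTop.2 fun a => ?_⟩
  by_contra! hfin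
  -- If only indices below `a` occurred, the approximations obtained as `T → ∞` would all have `Im
  -- v` in the closed set `(1 / a!)ℤ`, and so would their limit `h`.
  have hclosed : IsClosed {y : Siegel n | ∃ m : ℤ, ((a.factorial : ℕ) : ℝ) * y.v.im = m} := by
    have : Continuous fun y : Siegel n => ((a.factorial : ℕ) : ℝ) * y.v.im :=
      continuous_const.mul (Complex.continuous_im.comp continuous_v)
    convert Int.isClosedEmbedding_coe_real.isClosed_range.preimage this using 1
    ext y
    simp [eq_comm]
  have hmem : h ∈ {y : Siegel n | ∃ m : ℤ, ((a.factorial : ℕ) : ℝ) * y.v.im = m} := by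
    rw [← hclosed.closure_eq, Metric.mem_closure_iff]
    intro ε hε
    obtain ⟨T, hT⟩ := exists_gt (max C (C / ε ^ 2))
    have hTC : C < T := (le_max_left _ _).trans_lt hT
    have hT0 : 0 < T := hC0.trans hTC
    have hTε : C / T < ε ^ 2 := by
      rw [div_lt_comm₀ hT0 (by positivity)]
      exact (le_max_right _ _).trans_lt hT
    obtain ⟨y, q, hy, hqT, hd⟩ := hC h T hTC
    have hq1 := one_le_norm_gaussianInt hy.1
    have hq0 : 0 < ‖(q : ℂ)‖ := by linarith
    have hi := hy.mem_pointsOfNormSq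
    set i := q.norm.natAbs
    have hisq : √(i : ℝ) = ‖(q : ℂ)‖ := by
      rw [GaussianInt.natCast_natAbs_norm, GaussianInt.intCast_real_norm,
        Complex.normSq_eq_norm_sq, Real.sqrt_sq hq0.le]
    refine ⟨y, ?_, ?_⟩
    · have hia : i < a := by
        by_contra! hai
        refine hfin i hai (Metric.mem_thickening_iff.2 ⟨y, hi, ?_⟩)
        rw [hisq]
        refine lt_of_le_of_lt ?_ (mul_lt_mul_of_pos_right (lt_add_one C) (by positivity))
        refine le_of_sq_le_sq (hd.trans ?_) (by positivity)
        rw [mul_pow, div_le_iff₀ (by positivity)]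
        calc C = C * ‖(q : ℂ)‖⁻¹ * ‖(q : ℂ)‖ := by field_simp
          _ ≤ C * ‖(q : ℂ)‖⁻¹ * (C * T) := by gcongr
          _ = _ := by field_simp
      have hi0 : 0 < i := Int.natAbs_pos.2 fun h => hy.1 (GaussianInt.norm_eq_zero.1 h)
      obtain ⟨k, hk⟩ := Nat.dvd_factorial hi0 hia.le
      obtain ⟨m, hm⟩ := exists_natCast_mul_im_v_eq hi
      refine ⟨k * m, ?_⟩
      rw [hk]
      push_cast
      rw [← hm]
      ring
    · refine lt_of_pow_lt_pow_left₀ 2 hε.le (hd.trans_lt (lt_of_le_of_lt ?_ hTε))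
      gcongr
      exact le_mul_of_one_le_right hT0.le hq1
  obtain ⟨m, hm⟩ := hmem
  refine hirr ⟨(m : ℚ) / a.factorial, ?_⟩
  have := a.factorial_ne_zero
  push_cast
  rw [← hm]
  field_simp

/-- For a doubling measure, rescaling the radii changes the limsup of thickenings only by a null
set. Indexing by `|q|²` gives a sequence of radii tending to zero. -/
theorem ae_frequently_mem_thickening {C : ℝ} (hC : 0 < C) : ∀ᵐ h : Siegel n,
    ∃ᶠ i : ℕ in atTop, h ∈ Metric.thickening (C * (√i)⁻¹) (pointsOfNormSq n i) := by
  obtain ⟨C₀, hC₀, h₀⟩ := exists_frequently_mem_thickening n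
  have hr : Tendsto (fun i : ℕ => (√(i : ℝ))⁻¹) atTop (𝓝 0) :=
    (Real.tendsto_sqrt_atTop.comp tendsto_natCast_atTop_atTop).inv_tendsto_atTop
  have key := ((blimsup_thickening_mul_ae_eq (volume : Measure (Siegel n)) (fun _ => True)
    (pointsOfNormSq n) hC₀ _ hr).trans (blimsup_thickening_mul_ae_eq volume (fun _ => True)
    (pointsOfNormSq n) hC _ hr).symm).mem_iff
  filter_upwards [key, ae_irrational_im_v] with h hkey hirr
  rw [blimsup_true, blimsup_true, mem_limsup_iff_frequently_mem, mem_limsup_iff_frequently_mem]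
    at hkey
  exact hkey.1 (h₀ h hirr)

/-- The Khinchin-type divergence statement. -/
theorem ae_infinite_approximants {C : ℝ} (hC : 0 < C) : ∀ᵐ h : Siegel n,
    {y : Siegel n | y ∈ rationalPoints n ∧ h.gaugeDist y ≤ C / y.height}.Infinite := by
  filter_upwards [ae_frequently_mem_thickening hC, ae_irrational_im_v] with h hfreq hirr hfin
  have hpos : ∀ y ∈ rationalPoints n, 0 < dist h y := fun y hy => by
    refine dist_pos.2 ?_
    rintro rfl
    obtain ⟨-, a, b, hab⟩ := hy
    exact hirr ⟨b, by simp [hab]⟩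
  -- A point has infinitely many denominators, so infinitely many indices do not at once give
  -- infinitely many points. But finitely many points stay at positive distance from `h`, while the
  -- radii tend to zero.
  have hev : ∀ᶠ i : ℕ in atTop,
      ∀ y ∈ {y : Siegel n | y ∈ rationalPoints n ∧ h.gaugeDist y ≤ C / y.height},
        C * (√(i : ℝ))⁻¹ < dist h y := by
    refine (eventually_all_finite hfin).2 fun y hy => ?_
    have hr : Tendsto (fun i : ℕ => C * (√(i : ℝ))⁻¹) atTop (𝓝 (C * 0)) :=
      (Real.tendsto_sqrt_atTop.comp tendsto_natCast_atTop_atTop).inv_tendsto_atTop.const_mul C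
    rw [mul_zero] at hr
    exact hr.eventually_lt_const (hpos y hy.1)
  obtain ⟨i, hi, hlt⟩ := (hfreq.and_eventually hev).exists
  obtain ⟨y, ⟨q, hq, hqi⟩, hd⟩ := Metric.mem_thickening_iff.1 hi
  have hyR := hq.mem_rationalPoints
  refine absurd (hlt y ⟨hyR, hd.le.trans ?_⟩) hd.not_gt
  rw [← hqi, Real.sqrt_sq (norm_nonneg _), ← div_eq_mul_inv]
  have := one_le_height hyR
  gcongr
  exact hq.height_le

/-! ### The convergence case -/

theorem disjoint_closedBall_of_height_le {y y' : Siegel n} (hy : y ∈ rationalPoints n)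
    (hy' : y' ∈ rationalPoints n) (hne : y ≠ y') {k : ℕ} (hk : y.height ≤ 2 ^ (k + 1))
    (hk' : y'.height ≤ 2 ^ (k + 1)) :
    Disjoint (Metric.closedBall y ((1 / 2) ^ (k + 3)))
      (Metric.closedBall y' ((1 / 2) ^ (k + 3))) := by
  refine Metric.closedBall_disjoint_closedBall ?_
  obtain ⟨q, hq, hqh⟩ := exists_isDenominator_height hy
  obtain ⟨q', hq', hqh'⟩ := exists_isDenominator_height hy'
  rw [hqh] at hk
  rw [hqh'] at hk'
  -- Repulsion gives distance at least `2 ^ (-(k + 1))`, twice the sum of the two radii.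
  have h3 : 1 ≤ (dist y y' * 2 ^ (k + 1)) ^ 2 :=
    (hq.one_le_dist_sq_mul hq' hne).trans (by
      rw [mul_pow, sq (2 ^ (k + 1) : ℝ)]
      gcongr)
  have h4 : 1 ≤ dist y y' * 2 ^ (k + 1) := (one_le_sq_iff₀ (by positivity)).1 h3
  have h5 : (1 / 2 : ℝ) ^ (k + 1) ≤ dist y y' := by
    rw [one_div, inv_pow]
    exact (inv_le_iff_one_le_mul₀ (by positivity)).2 h4
  have h6 : (0 : ℝ) < (1 / 2) ^ (k + 1) := by positivity
  have h7 : (1 / 2 : ℝ) ^ (k + 3) = (1 / 2) ^ (k + 1) / 4 := by ring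
  linarith

theorem rpow_neg_le_of_two_pow_le {x α : ℝ} (hα : 0 ≤ α) {k : ℕ} (hx : 2 ^ k ≤ x) :
    x ^ (-α) ≤ (1 / 2) ^ k * ((2 : ℝ) ^ (-(α - 1))) ^ k := by
  have h2 : (0 : ℝ) < 2 ^ k := by positivity
  refine (Real.rpow_le_rpow_of_nonpos h2 hx (by linarith)).trans_eq ?_
  rw [← mul_pow, ← Real.rpow_natCast, ← Real.rpow_mul zero_le_two, mul_comm, Real.rpow_mul
    zero_le_two, Real.rpow_natCast]
  congr 1
  rw [one_div, ← Real.rpow_neg_one, ← Real.rpow_add two_pos]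
  ring_nf

/-- For heights in `[2 ^ m, 2 ^ (m + 1))`, each ball is compared with the concentric one of radius
`2 ^ (-(m + 3))`. Those are disjoint and lie in one fixed ball, and the volume ratio is a constant
times `(θ ^ N) ^ m` with `θ < 1`. -/
theorem tsum_volume_closedBall_ne_top {α : ℝ} (hα : 1 < α) {R : ℝ} (hR : 0 ≤ R) :
    ∑' y : {y : Siegel n // y ∈ rationalPoints n ∧ dist y 1 ≤ R},
      volume (Metric.closedBall y.1 (y.1.height ^ (-α))) ≠ ⊤ := by
  obtain ⟨N, c, C, hN, hc, hC, hvol⟩ := exists_volume_closedBall_bounds n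
  have hscale : ∀ y : {y : Siegel n // y ∈ rationalPoints n ∧ dist y 1 ≤ R},
      ∃ k : ℕ, (2 : ℝ) ^ k ≤ y.1.height ∧ y.1.height < 2 ^ (k + 1) := fun y =>
    exists_nat_pow_near (one_le_height y.2.1) one_lt_two
  choose k hk using hscale
  obtain ⟨θ, hθ⟩ : ∃ θ : ℝ, θ = 2 ^ (-(α - 1)) := ⟨_, rfl⟩
  have hθ0 : 0 < θ := hθ ▸ by positivity
  have hθ1 : θ < 1 := hθ ▸ Real.rpow_lt_one_of_one_lt_of_neg one_lt_two (by linarith)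
  have hball : ∀ (y : Siegel n) (m : ℕ), 2 ^ m ≤ y.height →
      volume (Metric.closedBall y (y.height ^ (-α)))
      ≤ ENNReal.ofReal (C / c * 8 ^ N * (θ ^ N) ^ m)
        * volume (Metric.closedBall y ((1 / 2) ^ (m + 3))) := fun y m hm => by
    have hy0 : 0 ≤ y.height ^ (-α) := Real.rpow_nonneg (le_trans (by positivity) hm) _
    refine (hvol y _ hy0).2.trans ?_
    refine le_trans ?_ (mul_le_mul_right (hvol y _ (by positivity)).1 _)
    rw [← ENNReal.ofReal_mul (by positivity)]
    refine ENNReal.ofReal_le_ofReal ?_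
    calc C * (y.height ^ (-α)) ^ N ≤ C * ((1 / 2) ^ m * θ ^ m) ^ N := by
          gcongr
          exact hθ ▸ rpow_neg_le_of_two_pow_le (by linarith) hm
      _ = C * ((8 * (1 / 2) ^ (m + 3)) * θ ^ m) ^ N := by
          congr 3
          rw [pow_add]
          ring
      _ = _ := by
          rw [mul_pow, mul_pow, pow_right_comm θ]
          field_simp
  set V := volume (Metric.closedBall (1 : Siegel n) (R + 1)) with hV
  have hVtop : V ≠ ⊤ := ((hvol _ _ (by positivity)).2.trans_lt ENNReal.ofReal_lt_top).ne
  have hfiber : ∀ m : ℕ, ∑' y : k ⁻¹' {m},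
      volume (Metric.closedBall y.1.1 (y.1.1.height ^ (-α)))
        ≤ ENNReal.ofReal (C / c * 8 ^ N * (θ ^ N) ^ m) * V := fun m => by
    have hle : ∀ y : k ⁻¹' {m}, volume (Metric.closedBall y.1.1 (y.1.1.height ^ (-α)))
        ≤ ENNReal.ofReal (C / c * 8 ^ N * (θ ^ N) ^ m)
          * volume (Metric.closedBall y.1.1 ((1 / 2) ^ (m + 3))) := fun y => by
      have hm : k y.1 = m := y.2
      exact hball y.1.1 m ((congrArg (fun t => (2 : ℝ) ^ t) hm).ge.trans (hk y.1).1)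
    refine (ENNReal.tsum_le_tsum hle).trans ?_
    rw [ENNReal.tsum_mul_left]
    gcongr
    refine (tsum_meas_le_meas_iUnion_of_disjoint volume (fun _ => measurableSet_closedBall)
      fun y y' hne => ?_).trans
      (measure_mono (Set.iUnion_subset fun y => ?_))
    · have hm : k y.1 = m := y.2
      have hm' : k y'.1 = m := y'.2
      exact disjoint_closedBall_of_height_le y.1.2.1 y'.1.2.1
        (fun h => hne (Subtype.ext (Subtype.ext h)))
        ((hk y.1).2.le.trans (congrArg (fun t => (2 : ℝ) ^ (t + 1)) hm).le)
        ((hk y'.1).2.le.trans (congrArg (fun t => (2 : ℝ) ^ (t + 1)) hm').le)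
    refine Metric.closedBall_subset_closedBall' ?_
    have h1 : (1 / 2 : ℝ) ^ (m + 3) ≤ 1 := pow_le_one₀ (by norm_num) (by norm_num)
    linarith [y.1.2.2]
  rw [← ENNReal.tsum_fiberwise _ k]
  refine ne_top_of_le_ne_top ?_ (ENNReal.tsum_le_tsum hfiber)
  rw [ENNReal.tsum_mul_right]
  refine ENNReal.mul_ne_top (Summable.tsum_ofReal_ne_top ?_) hVtop
  exact (summable_geometric_of_lt_one (by positivity) (pow_lt_one₀ hθ0.le hθ1 hN)).mul_left _

theorem countable_rationalPoints (n : ℕ) : (rationalPoints n).Countable := by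
  let φ : ℚ × ℚ → ℂ := fun s => (s.1 : ℂ) + (s.2 : ℂ) * Complex.I
  have hinj : Function.Injective (toProd (n := n)) := fun h k e =>
    Siegel.ext (congrArg Prod.fst e) (congrArg Prod.snd e)
  have hc := ((Set.countable_univ_pi fun _ : Fin n => Set.countable_range φ).prod
    (Set.countable_range φ)).preimage hinj
  refine hc.mono ?_
  rintro y ⟨hu, a, b, hab⟩
  refine ⟨fun i _ => ?_, (a, b), hab.symm⟩
  obtain ⟨c, d, hcd⟩ := hu i
  exact ⟨(c, d), hcd.symm⟩

/-- Borel–Cantelli. Heights are at least 1, so approximants of points in the ball of radius `R` lie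
in the ball of radius `R + 1`. -/
theorem ae_mem_closedBall_finite_approximants {α : ℝ} (hα : 1 < α) {R : ℝ} (hR : 0 ≤ R) :
    ∀ᵐ h : Siegel n, h ∈ Metric.closedBall 1 R →
      {y : Siegel n | y ∈ rationalPoints n ∧ h.gaugeDist y ≤ y.height ^ (-α)}.Finite := by
  have : Countable {y : Siegel n // y ∈ rationalPoints n ∧ dist y 1 ≤ R + 1} :=
    ((countable_rationalPoints n).mono fun _ hy => hy.1).to_subtype
  filter_upwards [ae_finite_setOfPred_mem
    (tsum_volume_closedBall_ne_top (n := n) hα (add_nonneg hR zero_le_one))] with h hfin hR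
  refine (hfin.image Subtype.val).subset ?_
  rintro y ⟨hy, hd⟩
  have hd' : dist h y ≤ y.height ^ (-α) := hd
  have h1 : dist h y ≤ 1 := hd'.trans
    (Real.rpow_le_one_of_one_le_of_nonpos (one_le_height hy) (by linarith))
  refine ⟨⟨y, hy, ?_⟩, Metric.mem_closedBall.2 hd', rfl⟩
  have := dist_triangle_left y 1 h
  rw [Metric.mem_closedBall] at hR
  linarith

/-- The Khinchin-type convergence statement. -/
theorem ae_not_infinite_approximants {α : ℝ} (hα : 1 < α) : ∀ᵐ h : Siegel n,
    ¬ {y : Siegel n | y ∈ rationalPoints n ∧ h.gaugeDist y ≤ y.height ^ (-α)}.Infinite := by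
  have := ae_all_iff.2 fun m : ℕ =>
    ae_mem_closedBall_finite_approximants (n := n) hα m.cast_nonneg
  filter_upwards [this] with h hh
  obtain ⟨m, hm⟩ := exists_nat_ge (dist h 1)
  exact Set.not_infinite.2 (hh m hm)

end Siegel

theorem theorem1p3 (n : ℕ) (hn : 1 ≤ n) :
    (∀ C : ℝ, 0 < C → ∀ᵐ h : Siegel n,
      {y : Siegel n | y ∈ Siegel.rationalPoints n ∧ h.gaugeDist y ≤ C / y.height}.Infinite) ∧
    (∀ᵐ h : Siegel n,
      {y : Siegel n | y ∈ Siegel.rationalPoints n ∧ h.gaugeDist y < y.height ^ (-1 : ℝ)}.Infinite) ∧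
    (∀ α : ℝ, 1 < α → ∀ᵐ h : Siegel n,
      ¬ {y : Siegel n | y ∈ Siegel.rationalPoints n ∧ h.gaugeDist y ≤ y.height ^ (-α)}.Infinite) ∧
    IsDiophantineExponent (volume : Measure (Siegel n)) Siegel.gaugeDist
      (Siegel.rationalPoints n) Siegel.height 1 := by
  refine ⟨fun C hC => Siegel.ae_infinite_approximants hC, ?_,
    fun α hα => Siegel.ae_not_infinite_approximants hα, ?_,
    fun ε hε => Siegel.ae_not_infinite_approximants (by linarith)⟩
  -- The constant `1/2` makes the inequality strict.
  · filter_upwards [Siegel.ae_infinite_approximants (n := n) one_half_pos] with h hh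
    refine hh.mono fun y hy => ⟨hy.1, hy.2.trans_lt ?_⟩
    have := Siegel.one_le_height hy.1
    rw [Real.rpow_neg_one, ← one_div]
    gcongr
    norm_num
  · filter_upwards [Siegel.ae_infinite_approximants (n := n) one_pos] with h hh
    refine hh.mono fun y hy => ⟨hy.1, hy.2.trans_eq ?_⟩
    change _ = y.height ^ (-1 : ℝ)
    rw [Real.rpow_neg_one, one_div]
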